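/- \textbf{The exclusion game.} Let $1\le m\le n$. Alice receives $\vec x\in\{0,1\}^n$ and sends one quantum message to Bob, with no shared entanglement. Bob receives a set $y\subseteq[n]$ with $|y|=m$, measures the message, and must output a string $\vec z_y\in\{0,1\}^m$ with $\vec z_y\ne\mathcal M_y(\vec x)$, where $\mathcal M_y(\vec x)$ is the restriction of $\vec x$ to the positions in $y$. If $(X,Y)=(\vec x,y)$ has joint distribution $\mu$ and Alice's message on input $\vec x$ is the state $\rho_{\vec x}$ of a system $M_Q$, the information cost of the strategy is the quantum conditional mutual information $$IC_\mu(M_Q)=I(X:M_Q|Y)=S(X,Y)+S(M_Q,Y)-S(Y)-S(X,M_Q,Y)$$ of the state $\sum_{\vec x,y}\mu(\vec x,y)\,|\vec x\rangle\langle\vec x|\otimes\rho_{\vec x}\otimes|y\rangle\langle y|$, where $S(\rho)=-\mathrm{tr}(\rho\log_2\rho)$. \textbf{The strategy.} Let $\theta_m=2\arctan(2^{1/m}-1)$, $|\psi_0(\theta)\rangle=\cos\frac\theta2|0\rangle+\sin\frac\theta2|1\rangle$, $|\psi_1(\theta)\rangle=\cos\frac\theta2|0\rangle-\sin\frac\theta2|1\rangle$.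 On input $\vec x$, Alice sends the $n$-qubit state $|\Psi_{\vec x}(\theta_m)\rangle=\bigotimes_{i=1}^n|\psi_{x_i}(\theta_m)\rangle$. On input $y$, Bob measures the $m$ qubits at the positions in $y$ with the projectors $|\zeta_{\vec z}\rangle\langle\zeta_{\vec z}|$, $\vec z\in\{0,1\}^m$, where $$|\zeta_{\vec z}\rangle=\frac1{\sqrt{2^m}}\Big(|\vec 0\rangle-\sum_{\vec s\ne\vec 0}(-1)^{\vec z\cdot\vec s}|\vec s\rangle\Big),$$ and outputs the outcome $\vec z$. \textbf{Theorem 1.} Let $m=m(n)\le n$ with $m\in\omega(n^{1/2+\beta})$ for some $\beta>0$. The above is a valid one-way quantum strategy (the messages are states and Bob's operators form a measurement), and: (i) for every $n$ with $m\ge1$ and all inputs $\vec x$, $y$, Bob outputs with certainty a string $\vec z_y\ne\mathcal M_y(\vec x)$; (ii) for every choice of joint input distributions $\mu=\mu_n$ on pairs $(\vec x,y)$ (with $\vec x$ and $y$ possibly correlated), $IC_{\mu_n}(M_Q)\to0$ as $n\to\infty$. -/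

import Mathlib

open Filter Topology Asymptotics
open scoped ComplexOrder

namespace ExclusionGame

noncomputable section

/-- Bit strings indexed by `ι`; they also label the computational basis of the qubits `ι`. -/
abbrev BitString (ι : Type) : Type := ι → Bool

/-- Bob's possible inputs: the sets of `m` locations in a string of length `n`. -/
abbrev Locations (n m : ℕ) : Type := {y : Finset (Fin n) // y.card = m}

/-- The restriction of the string `x` to the locations in `y`: the string of length `m` that Bob
has to exclude, with its bits labelled by the elements of `y`. -/
def restrictTo {n m : ℕ} (y : Locations n m) (x : BitString (Fin n)) : BitString y.1 :=
  fun i => x i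

/-! ### Quantum information -/

/-- The von Neumann entropy `-tr (ρ log₂ ρ)`; here `log₂ ρ` is the Hermitian functional calculus,
and the value of `Real.logb 2` at `0` realizes the convention `0 log 0 = 0`. -/
def vonNeumannEntropy {d : Type} [Fintype d] [DecidableEq d] (ρ : Matrix d d ℂ) : ℝ :=
  -(ρ * cfc (Real.logb 2) ρ).trace.re

/-- The reduced state on `AC` of a state on `ABC`. -/
def reduceAC {a b c : Type} [Fintype b] (ρ : Matrix (a × b × c) (a × b × c) ℂ) :
    Matrix (a × c) (a × c) ℂ :=
  fun p q => ∑ k : b, ρ (p.1, k, p.2) (q.1, k, q.2)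

/-- The reduced state on `BC` of a state on `ABC`. -/
def reduceBC {a b c : Type} [Fintype a] (ρ : Matrix (a × b × c) (a × b × c) ℂ) :
    Matrix (b × c) (b × c) ℂ :=
  fun p q => ∑ k : a, ρ (k, p) (k, q)

/-- The reduced state on `C` of a state on `ABC`. -/
def reduceC {a b c : Type} [Fintype a] [Fintype b] (ρ : Matrix (a × b × c) (a × b × c) ℂ) :
    Matrix c c ℂ :=
  fun p q => ∑ k : a, ∑ l : b, ρ (k, l, p) (k, l, q)

/-- The quantum conditional mutual information
`I(A : B | C) = S(A, C) + S(B, C) - S(C) - S(A, B, C)`. -/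
def condMutualInfo {a b c : Type} [Fintype a] [DecidableEq a] [Fintype b] [DecidableEq b]
    [Fintype c] [DecidableEq c] (ρ : Matrix (a × b × c) (a × b × c) ℂ) : ℝ :=
  vonNeumannEntropy (reduceAC ρ) + vonNeumannEntropy (reduceBC ρ)
    - vonNeumannEntropy (reduceC ρ) - vonNeumannEntropy ρ

/-- The rank-one operator `|v⟩⟨v|`. -/
def ketBra {d : Type} (v : d → ℂ) : Matrix d d ℂ := Matrix.vecMulVec v (star v)

/-- The operator `A` on the qubits in `y`, tensored with the identity on all other qubits. -/
def onSubsystem {n : ℕ} (y : Finset (Fin n)) (A : Matrix (BitString y) (BitString y) ℂ) :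
    Matrix (BitString (Fin n)) (BitString (Fin n)) ℂ :=
  fun s t => if ∀ i, i ∉ y → s i = t i then A (fun i => s i) (fun i => t i) else 0

/-! ### One-way quantum strategies for the exclusion game -/

/-- A one-way quantum strategy without shared entanglement: on input `x`, Alice sends the density
matrix `message x` on the system with basis `d`; on input `y`, Bob measures it with the POVM
`measurement y`, whose outcome, a string of bits labelled by the elements of `y`, is his output. -/
structure OneWayStrategy (n m : ℕ) (d : Type) [Fintype d] [DecidableEq d] where
  message : BitString (Fin n) → Matrix d d ℂ
  message_posSemidef : ∀ x, (message x).PosSemidef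
  message_trace : ∀ x, (message x).trace = 1
  measurement : (y : Locations n m) → BitString y.1 → Matrix d d ℂ
  measurement_posSemidef : ∀ y z, (measurement y z).PosSemidef
  measurement_sum : ∀ y, ∑ z, measurement y z = 1

namespace OneWayStrategy

variable {n m : ℕ} {d : Type} [Fintype d] [DecidableEq d]

/-- The probability (Born rule) that Bob outputs `z` on inputs `x`, `y`. -/
def outputProb (S : OneWayStrategy n m d) (x : BitString (Fin n)) (y : Locations n m)
    (z : BitString y.1) : ℝ :=
  (S.measurement y z * S.message x).trace.re

/-- On all inputs, every string that Bob may output differs from the restriction of `x` to `y`. -/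
def AlwaysWins (S : OneWayStrategy n m d) : Prop :=
  ∀ (x : BitString (Fin n)) (y : Locations n m) (z : BitString y.1),
    S.outputProb x y z ≠ 0 → z ≠ restrictTo y x

/-- The joint state `∑ μ(x, y) |x⟩⟨x| ⊗ message x ⊗ |y⟩⟨y|` of Alice's input `X`, the message `M`
and Bob's input `Y`, for inputs distributed according to `μ`. -/
def jointState (S : OneWayStrategy n m d) (μ : BitString (Fin n) × Locations n m → ℝ) :
    Matrix (BitString (Fin n) × d × Locations n m) (BitString (Fin n) × d × Locations n m) ℂ :=
  fun p q => if p.1 = q.1 ∧ p.2.2 = q.2.2 then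
    (μ (p.1, p.2.2) : ℂ) * S.message p.1 p.2.1 q.2.1 else 0

/-- The information cost `I(X : M | Y)` for the input distribution `μ`. -/
def infoCost (S : OneWayStrategy n m d) (μ : BitString (Fin n) × Locations n m → ℝ) : ℝ :=
  condMutualInfo (S.jointState μ)

end OneWayStrategy

/-! ### The Pusey-Barrett-Rudolph states and measurement -/

/-- The angle `θ_r = 2 arctan (2^(1/r) - 1)`. -/
def pbrAngle (r : ℕ) : ℝ := 2 * Real.arctan ((2 : ℝ) ^ (1 / (r : ℝ)) - 1)

/-- `|ψ_b(θ)⟩ = cos (θ/2) |0⟩ + (-1)^b sin (θ/2) |1⟩`; the second argument is `b`. -/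
def pbrQubit (θ : ℝ) : Bool → Bool → ℂ
  | _, false => (Real.cos (θ / 2) : ℂ)
  | false, true => (Real.sin (θ / 2) : ℂ)
  | true, true => -(Real.sin (θ / 2) : ℂ)

/-- The product state `|Ψ_x(θ)⟩ = ⨂ᵢ |ψ_{xᵢ}(θ)⟩`. -/
def pbrState {ι : Type} [Fintype ι] (θ : ℝ) (x : BitString ι) : BitString ι → ℂ :=
  fun s => ∏ i, pbrQubit θ (x i) (s i)

/-- `z · s`, the number of positions where both strings have bit `1`. -/
def bitDot {ι : Type} [Fintype ι] (z s : BitString ι) : ℕ :=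
  (Finset.univ.filter fun i => z i = true ∧ s i = true).card

/-- `|ζ_z⟩ = 2^(-r/2) (|0⟩ - ∑_{s ≠ 0} (-1)^(z · s) |s⟩)`, where `r` is the number of qubits. -/
def pbrZeta {ι : Type} [Fintype ι] (z : BitString ι) : BitString ι → ℂ :=
  fun s => (1 / (Real.sqrt (2 ^ Fintype.card ι) : ℂ)) *
    (if ∀ i, s i = false then 1 else -(-1) ^ bitDot z s)

end

end ExclusionGame

open ExclusionGame

namespace ExclusionGame

open Matrix

/-! ### Entropies of explicitly diagonalized matrices -/

/-! Exclusion: in `⟨ζ_x|Ψ_x⟩` the signs cancel, leaving a multiple of `2 cos^m - (cos + sin)^m` at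
`θ_m / 2`, which vanishes because `1 + tan (θ_m / 2) = 2^(1/m)` (`sum_pbrZeta_mul_pbrState`).

Information: the messages are pure, so `S(X,Y)` and `S(X,M,Y)` cancel and the cost is the average
entropy of Bob's conditional states (`infoCost_of_pure`). All `|Ψ_x⟩` have the same law in the
computational basis, that of `n` independent bits with bias `p = sin² (θ_m / 2)`; hence so does
every mixture of them, whatever `μ` is. Dephasing does not lower entropy
(`sum_negMulLog_eigenvalues_le`), so the cost is at most `n h(p)`, with `h` the binary entropy.
Since `p ≤ 1/m²` and eventually `m ≥ n^(1/2 + β)`, this is `O(n^(-β))`. -/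

theorem aeval_isometry_conj_diagonal_mul {d e : Type} [Fintype d] [DecidableEq d] [Fintype e]
    [DecidableEq e] (V : Matrix d e ℂ) (hV : Vᴴ * V = 1) (w : e → ℝ) (q : Polynomial ℝ) :
    Polynomial.aeval (V * diagonal (fun i => (w i : ℂ)) * Vᴴ) q * V =
      V * diagonal (fun i => ((q.eval (w i) : ℝ) : ℂ)) := by
  induction q using Polynomial.induction_on' with
  | add p q hp hq =>
    rw [map_add, Matrix.add_mul, hp, hq, ← Matrix.mul_add, diagonal_add]
    simp only [Polynomial.eval_add, Complex.ofReal_add]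
  | monomial k a =>
    have hpow : ∀ k : ℕ, (V * diagonal (fun i => (w i : ℂ)) * Vᴴ) ^ k * V =
        V * diagonal (fun i => ((w i : ℂ)) ^ k) := by
      intro k
      induction k with
      | zero => simp
      | succ k ih =>
        rw [pow_succ, Matrix.mul_assoc, Matrix.mul_assoc _ Vᴴ V, hV, Matrix.mul_one,
          ← Matrix.mul_assoc, ih, Matrix.mul_assoc, diagonal_mul_diagonal]
        simp only [pow_succ]
    rw [Polynomial.aeval_monomial, Matrix.mul_assoc, hpow, Algebra.algebraMap_eq_smul_one,
      Matrix.smul_mul, Matrix.one_mul, ← Matrix.mul_smul, ← diagonal_smul]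
    congr 2
    funext i
    simp

/-- `V` may be rectangular: the kernel outside its range contributes nothing, because `log₂ ρ` is
multiplied by `ρ`. -/
theorem vonNeumannEntropy_isometry_conj_diagonal {d e : Type} [Fintype d] [DecidableEq d]
    [Fintype e] [DecidableEq e] (V : Matrix d e ℂ) (hV : Vᴴ * V = 1) (w : e → ℝ) :
    vonNeumannEntropy (V * diagonal (fun i => (w i : ℂ)) * Vᴴ) =
      (∑ i, Real.negMulLog (w i)) / Real.log 2 := by
  set ρ := V * diagonal (fun i => (w i : ℂ)) * Vᴴ with hρ
  have hsa : IsSelfAdjoint ρ := by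
    rw [isSelfAdjoint_iff, star_eq_conjTranspose, hρ]
    simp only [conjTranspose_mul, conjTranspose_conjTranspose, diagonal_conjTranspose,
      Matrix.mul_assoc]
    congr 3
    funext i
    simp
  -- Interpolating the logarithm on a finite set turns `cfc` into a polynomial. Adding the weights
  -- to the nodes avoids showing that they lie in the spectrum.
  have hfin : (spectrum ℝ ρ ∪ Set.range w).Finite :=
    (Matrix.finite_real_spectrum).union (Set.finite_range w)
  obtain ⟨q, hq⟩ : ∃ q : Polynomial ℝ, ∀ x ∈ spectrum ℝ ρ ∪ Set.range w,
      q.eval x = Real.logb 2 x := by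
    refine ⟨Lagrange.interpolate hfin.toFinset id (Real.logb 2), fun x hx => ?_⟩
    exact Lagrange.eval_interpolate_at_node (v := id) _ (Set.injOn_id _) (hfin.mem_toFinset.2 hx)
  have hcfc : cfc (Real.logb 2) ρ = Polynomial.aeval ρ q := by
    rw [← cfc_polynomial q ρ hsa]
    exact cfc_congr fun x hx => (hq x (Or.inl hx)).symm
  have htr : (ρ * Polynomial.aeval ρ q).trace = ((∑ i, w i * Real.logb 2 (w i) : ℝ) : ℂ) := by
    rw [trace_mul_comm]
    nth_rewrite 2 [hρ]
    rw [← Matrix.mul_assoc, ← Matrix.mul_assoc, aeval_isometry_conj_diagonal_mul V hV,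
      trace_mul_comm, ← Matrix.mul_assoc, ← Matrix.mul_assoc, hV, Matrix.one_mul,
      diagonal_mul_diagonal, trace_diagonal]
    push_cast
    refine Finset.sum_congr rfl fun i _ => ?_
    rw [hq (w i) (Or.inr ⟨i, rfl⟩), mul_comm]
  rw [vonNeumannEntropy, hcfc, htr, Complex.ofReal_re, Finset.sum_div, ← Finset.sum_neg_distrib]
  refine Finset.sum_congr rfl fun i _ => ?_
  rw [Real.negMulLog, Real.logb]
  ring

theorem vonNeumannEntropy_diagonal {d : Type} [Fintype d] [DecidableEq d] (w : d → ℝ) :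
    vonNeumannEntropy (diagonal fun i => (w i : ℂ)) =
      (∑ i, Real.negMulLog (w i)) / Real.log 2 := by
  simpa using vonNeumannEntropy_isometry_conj_diagonal (1 : Matrix d d ℂ) (by simp) w

/-- The entropy of a block diagonal Hermitian matrix, in terms of the eigenvalues of the blocks. -/
theorem vonNeumannEntropy_blockDiagonal {d o : Type} [Fintype d] [DecidableEq d] [Fintype o]
    [DecidableEq o] (A : o → Matrix d d ℂ) (hA : ∀ k, (A k).IsHermitian) :
    vonNeumannEntropy (blockDiagonal A) =
      (∑ k, ∑ i, Real.negMulLog ((hA k).eigenvalues i)) / Real.log 2 := by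
  let U : o → Matrix d d ℂ := fun k => ((hA k).eigenvectorUnitary : Matrix d d ℂ)
  have hU : ∀ k, (U k)ᴴ * U k = 1 := fun k => Unitary.coe_star_mul_self (hA k).eigenvectorUnitary
  have hV : (blockDiagonal U)ᴴ * blockDiagonal U = 1 := by
    rw [blockDiagonal_conjTranspose, ← blockDiagonal_mul]
    simp only [hU]
    exact blockDiagonal_one
  have hspec : ∀ k, A k =
      U k * diagonal (fun i => (((hA k).eigenvalues i : ℝ) : ℂ)) * (U k)ᴴ := fun k => by
    conv_lhs => rw [(hA k).spectral_theorem]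
    rfl
  have key : blockDiagonal A = blockDiagonal U *
      diagonal (fun p : d × o => (((hA p.2).eigenvalues p.1 : ℝ) : ℂ)) * (blockDiagonal U)ᴴ := by
    rw [blockDiagonal_conjTranspose,
      ← blockDiagonal_diagonal (fun k i => (((hA k).eigenvalues i : ℝ) : ℂ)),
      ← blockDiagonal_mul, ← blockDiagonal_mul]
    congr 1
    funext k
    exact hspec k
  rw [key, vonNeumannEntropy_isometry_conj_diagonal _ hV, Fintype.sum_prod_type_right]

/-- The Shannon entropy of the diagonal is at least that of the spectrum. -/
theorem sum_negMulLog_eigenvalues_le {d : Type} [Fintype d] [DecidableEq d] {A : Matrix d d ℂ}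
    (hA : A.PosSemidef) :
    ∑ i, Real.negMulLog (hA.1.eigenvalues i) ≤ ∑ s, Real.negMulLog (A s s).re := by
  let U : Matrix d d ℂ := (hA.1.eigenvectorUnitary : Matrix d d ℂ)
  have h1 : Uᴴ * U = 1 := Unitary.coe_star_mul_self hA.1.eigenvectorUnitary
  have h2 : U * Uᴴ = 1 := Unitary.coe_mul_star_self hA.1.eigenvectorUnitary
  have hspec : A = U * diagonal (fun i => ((hA.1.eigenvalues i : ℝ) : ℂ)) * Uᴴ := by
    conv_lhs => rw [hA.1.spectral_theorem]
    rfl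
  -- The matrix `|U s i|²` is doubly stochastic: the columns split the spectral entropy, the rows
  -- are the weights in Jensen's inequality.
  have hrow : ∀ s, ∑ i, Complex.normSq (U s i) = 1 := fun s => by
    have := congrFun (congrFun h2 s) s
    simp only [mul_apply, conjTranspose_apply, one_apply_eq, RCLike.star_def,
      Complex.mul_conj] at this
    exact_mod_cast this
  have hcol : ∀ i, ∑ s, Complex.normSq (U s i) = 1 := fun i => by
    have := congrFun (congrFun h1 i) i
    simp only [mul_apply, conjTranspose_apply, one_apply_eq, RCLike.star_def,
      mul_comm ((starRingEnd ℂ) _), Complex.mul_conj] at this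
    exact_mod_cast this
  have hdiag : ∀ s, (A s s).re = ∑ i, Complex.normSq (U s i) * hA.1.eigenvalues i := fun s => by
    have : A s s = ((∑ i, Complex.normSq (U s i) * hA.1.eigenvalues i : ℝ) : ℂ) := by
      conv_lhs => rw [hspec]
      rw [mul_apply]
      simp only [mul_diagonal, conjTranspose_apply, RCLike.star_def]
      push_cast
      refine Finset.sum_congr rfl fun i _ => ?_
      rw [← Complex.mul_conj]
      ring
    rw [this, Complex.ofReal_re]
  calc ∑ i, Real.negMulLog (hA.1.eigenvalues i)
      = ∑ i, ∑ s, Complex.normSq (U s i) * Real.negMulLog (hA.1.eigenvalues i) := by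
        simp only [← Finset.sum_mul, hcol, one_mul]
    _ = ∑ s, ∑ i, Complex.normSq (U s i) * Real.negMulLog (hA.1.eigenvalues i) :=
        Finset.sum_comm
    _ ≤ ∑ s, Real.negMulLog (A s s).re := by
        refine Finset.sum_le_sum fun s _ => ?_
        rw [hdiag]
        have := Real.concaveOn_negMulLog.le_map_sum (t := Finset.univ)
          (w := fun i => Complex.normSq (U s i)) (p := hA.1.eigenvalues)
          (fun i _ => Complex.normSq_nonneg _) (hrow s) (fun i _ => hA.eigenvalues_nonneg i)
        simpa only [smul_eq_mul] using this

/-- Merging nonnegative weights does not increase the Shannon entropy. -/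
theorem negMulLog_sum_le {ι : Type} (t : Finset ι) (w : ι → ℝ) (hw : ∀ i ∈ t, 0 ≤ w i) :
    Real.negMulLog (∑ i ∈ t, w i) ≤ ∑ i ∈ t, Real.negMulLog (w i) := by
  rw [Real.negMulLog, neg_mul, Finset.sum_mul, ← Finset.sum_neg_distrib]
  refine Finset.sum_le_sum fun i hi => ?_
  rw [Real.negMulLog, neg_mul, neg_le_neg_iff]
  rcases (hw i hi).eq_or_lt with h | h
  · simp [← h]
  · exact mul_le_mul_of_nonneg_left
      (Real.log_le_log h (Finset.single_le_sum hw hi)) h.le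

/-- The Shannon entropy of the traces of the blocks is at most that of their spectra. -/
theorem negMulLog_trace_le {d : Type} [Fintype d] [DecidableEq d] {A : Matrix d d ℂ}
    (hA : A.PosSemidef) :
    Real.negMulLog A.trace.re ≤ ∑ i, Real.negMulLog (hA.1.eigenvalues i) := by
  have : A.trace.re = ∑ i, hA.1.eigenvalues i := by
    rw [hA.1.trace_eq_sum_eigenvalues]
    simp
  rw [this]
  exact negMulLog_sum_le _ _ fun i _ => hA.eigenvalues_nonneg i

/-! ### The Pusey-Barrett-Rudolph strategy -/

theorem ketBra_apply {d : Type} (v : d → ℂ) (s t : d) : ketBra v s t = v s * star (v t) := rfl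

theorem posSemidef_ketBra {d : Type} [Fintype d] (v : d → ℂ) : (ketBra v).PosSemidef :=
  posSemidef_vecMulVec_self_star v

theorem trace_ketBra {d : Type} [Fintype d] (v : d → ℂ) :
    (ketBra v).trace = ((∑ s, Complex.normSq (v s) : ℝ) : ℂ) := by
  simp [trace, ketBra_apply, Complex.mul_conj]

/-- The amplitude embedding `|c⟩ ↦ |v⟩ ⊗ |c⟩`, where `v` is a vector on the qubits in `y` and `c`
a basis label of the other qubits. -/
def tensorEmbedding {n : ℕ} (y : Finset (Fin n)) (v : BitString y → ℂ) :
    Matrix (BitString (Fin n)) (BitString {i // i ∉ y}) ℂ :=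
  fun s c => if (fun i : {i // i ∉ y} => s i) = c then v (fun i => s i) else 0

/-- This form makes positivity immediate and reduces annihilating a state to annihilating it by the
right-hand factor. -/
theorem onSubsystem_ketBra {n : ℕ} (y : Finset (Fin n)) (v : BitString y → ℂ) :
    onSubsystem y (ketBra v) = tensorEmbedding y v * (tensorEmbedding y v)ᴴ := by
  ext s t
  have hiff : (∀ i, i ∉ y → s i = t i) ↔
      (fun i : {i // i ∉ y} => t i) = fun i : {i // i ∉ y} => s i :=
    ⟨fun h => funext fun i => (h i i.2).symm, fun h i hi => (congrFun h ⟨i, hi⟩).symm⟩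
  simp only [onSubsystem, mul_apply, conjTranspose_apply, tensorEmbedding, ite_mul, zero_mul,
    Finset.sum_ite_eq, Finset.mem_univ, if_true, ketBra_apply, hiff]
  split_ifs <;> simp

theorem posSemidef_onSubsystem_ketBra {n : ℕ} (y : Finset (Fin n)) (v : BitString y → ℂ) :
    (onSubsystem y (ketBra v)).PosSemidef := by
  rw [onSubsystem_ketBra]
  exact posSemidef_self_mul_conjTranspose _

theorem sum_onSubsystem {n : ℕ} {κ : Type} [Fintype κ] (y : Finset (Fin n))
    (A : κ → Matrix (BitString y) (BitString y) ℂ) :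
    ∑ k, onSubsystem y (A k) = onSubsystem y (∑ k, A k) := by
  ext s t
  simp only [onSubsystem, Matrix.sum_apply]
  split_ifs <;> simp

theorem onSubsystem_one {n : ℕ} (y : Finset (Fin n)) : onSubsystem y 1 = 1 := by
  ext s t
  simp only [onSubsystem, one_apply]
  by_cases h : s = t
  · simp [h]
  · rw [if_neg h]
    split_ifs with h1 h2
    · refine absurd (funext fun i => ?_) h
      by_cases hi : i ∈ y
      · exact congrFun h2 ⟨i, hi⟩
      · exact h1 i hi
    · rfl
    · rfl

/-! ### Completeness of the measurement basis -/

theorem neg_one_pow_bitDot {ι : Type} [Fintype ι] (z s : BitString ι) :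
    (-1 : ℂ) ^ bitDot z s = ∏ i, if z i = true ∧ s i = true then -1 else 1 := by
  rw [bitDot, Finset.prod_ite]
  simp

/-- Orthogonality of the characters of `(ℤ/2)^ι`: the sum factors over sites, and a site where `s`
and `t` differ gives `1 - 1 = 0`. -/
theorem sum_neg_one_pow_bitDot_mul {ι : Type} [Fintype ι] [DecidableEq ι] (s t : BitString ι) :
    ∑ z : BitString ι, (-1 : ℂ) ^ bitDot z s * (-1) ^ bitDot z t =
      if s = t then 2 ^ Fintype.card ι else 0 := by
  simp only [neg_one_pow_bitDot, ← Finset.prod_mul_distrib]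
  have := (Fintype.prod_sum (fun (i : ι) (b : Bool) =>
    (if b = true ∧ s i = true then (-1 : ℂ) else 1) *
      if b = true ∧ t i = true then -1 else 1)).symm
  rw [this]
  have hterm : ∀ i, (∑ b : Bool, (if b = true ∧ s i = true then (-1 : ℂ) else 1) *
      if b = true ∧ t i = true then -1 else 1) = if s i = t i then 2 else 0 := fun i => by
    cases s i <;> cases t i <;> norm_num
  simp only [hterm]
  split_ifs with h
  · simp [h]
  · obtain ⟨i, hi⟩ := Function.ne_iff.1 h
    exact Finset.prod_eq_zero (Finset.mem_univ i) (if_neg hi)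

theorem sum_ketBra_pbrZeta {ι : Type} [Fintype ι] [DecidableEq ι] :
    ∑ z : BitString ι, ketBra (pbrZeta z) = 1 := by
  ext s t
  have hsq : (1 / (Real.sqrt (2 ^ Fintype.card ι) : ℂ)) *
      (1 / (Real.sqrt (2 ^ Fintype.card ι) : ℂ)) = 1 / 2 ^ Fintype.card ι := by
    rw [div_mul_div_comm, one_mul, ← Complex.ofReal_mul, Real.mul_self_sqrt (by positivity)]
    push_cast
    rfl
  -- Up to signs independent of `z`, the `ζ_z` are the Hadamard basis; at `s = 0` the character
  -- equals 1, so one formula covers both cases.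
  let sgn : BitString ι → ℂ := fun s => if ∀ i, s i = false then 1 else -1
  have hsgn : ∀ s, sgn s * sgn s = 1 := fun s => by
    simp only [sgn]
    split_ifs <;> norm_num
  have hz : ∀ z s : BitString ι, pbrZeta z s =
      (1 / (Real.sqrt (2 ^ Fintype.card ι) : ℂ)) * (sgn s * (-1) ^ bitDot z s) := fun z s => by
    simp only [pbrZeta, sgn]
    split_ifs with h
    · simp [bitDot, h]
    · ring
  have hstar : ∀ z s : BitString ι, star (pbrZeta z s) = pbrZeta z s := fun z s => by
    rw [hz]
    simp only [sgn]
    split_ifs <;> simp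
  rw [Matrix.sum_apply]
  simp only [ketBra_apply, hstar]
  calc ∑ z, pbrZeta z s * pbrZeta z t
      = (1 / 2 ^ Fintype.card ι) * (sgn s * sgn t) *
          ∑ z : BitString ι, (-1 : ℂ) ^ bitDot z s * (-1) ^ bitDot z t := by
        rw [Finset.mul_sum, ← hsq]
        refine Finset.sum_congr rfl fun z _ => ?_
        rw [hz, hz]
        ring
    _ = (1 : Matrix (BitString ι) (BitString ι) ℂ) s t := by
        rw [sum_neg_one_pow_bitDot_mul, one_apply]
        split_ifs with h
        · rw [h, hsgn]
          field_simp
        · ring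

theorem sum_onSubsystem_pbrZeta {n : ℕ} (y : Finset (Fin n)) :
    ∑ z : BitString y, onSubsystem y (ketBra (pbrZeta z)) = 1 := by
  rw [sum_onSubsystem, sum_ketBra_pbrZeta, onSubsystem_one]

/-- The probability of the bit `b` when `|ψ_0(θ)⟩` or `|ψ_1(θ)⟩` is measured in the computational
basis. -/
noncomputable def pbrBitProb (θ : ℝ) (b : Bool) : ℝ :=
  if b then Real.sin (θ / 2) ^ 2 else Real.cos (θ / 2) ^ 2

theorem sum_pbrBitProb (θ : ℝ) : ∑ b, pbrBitProb θ b = 1 := by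
  simp [pbrBitProb]

/-- The input affects only the signs of the amplitudes, so one distribution `Q` serves all messages
in `infoCost_le_of_pure`. -/
theorem normSq_pbrState {ι : Type} [Fintype ι] (θ : ℝ) (x s : BitString ι) :
    Complex.normSq (pbrState θ x s) = ∏ i, pbrBitProb θ (s i) := by
  rw [pbrState, map_prod]
  refine Finset.prod_congr rfl fun i _ => ?_
  cases x i <;> cases s i <;>
    simp [pbrQubit, pbrBitProb, Complex.normSq_ofReal, sq, -Complex.ofReal_cos,
      -Complex.ofReal_sin]

theorem sum_prod_pbrBitProb {ι : Type} [Fintype ι] [DecidableEq ι] (θ : ℝ) :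
    ∑ s : BitString ι, ∏ i, pbrBitProb θ (s i) = 1 := by
  rw [← Fintype.prod_sum (fun (_ : ι) b => pbrBitProb θ b)]
  simp only [sum_pbrBitProb, Finset.prod_const_one]

theorem trace_ketBra_pbrState {ι : Type} [Fintype ι] [DecidableEq ι] (θ : ℝ) (x : BitString ι) :
    (ketBra (pbrState θ x)).trace = 1 := by
  simp [trace_ketBra, normSq_pbrState, sum_prod_pbrBitProb]

theorem cos_add_sin_pbrAngle (r : ℕ) :
    Real.cos (pbrAngle r / 2) + Real.sin (pbrAngle r / 2) =
      2 ^ (1 / (r : ℝ)) * Real.cos (pbrAngle r / 2) := by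
  rw [pbrAngle, mul_div_cancel_left₀ _ two_ne_zero]
  have hc : Real.cos (Real.arctan ((2 : ℝ) ^ (1 / (r : ℝ)) - 1)) ≠ 0 :=
    (Real.cos_arctan_pos _).ne'
  have := Real.tan_mul_cos hc
  rw [Real.tan_arctan] at this
  rw [← this]
  ring

/-- The outcome `x` of the measurement is orthogonal to the state prepared for `x`. -/
theorem sum_pbrZeta_mul_pbrState {ι : Type} [Fintype ι] [DecidableEq ι] [Nonempty ι]
    (x : BitString ι) :
    ∑ s, star (pbrZeta x s) * pbrState (pbrAngle (Fintype.card ι)) x s = 0 := by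
  set θ := pbrAngle (Fintype.card ι)
  let amp : Bool → ℂ := fun b => if b then (Real.sin (θ / 2) : ℂ) else (Real.cos (θ / 2) : ℂ)
  have hstate : ∀ s, pbrState θ x s = (-1) ^ bitDot x s * ∏ i, amp (s i) := fun s => by
    rw [neg_one_pow_bitDot, pbrState, ← Finset.prod_mul_distrib]
    refine Finset.prod_congr rfl fun i _ => ?_
    cases x i <;> cases s i <;> simp [pbrQubit, amp]
  have hsq : ∀ k : ℕ, (-1 : ℂ) ^ k * (-1) ^ k = 1 := fun k => by
    rw [← mul_pow]; norm_num
  -- The characters of `ζ_x` and `Ψ_x` cancel. Every term then has sign `-1` except `s = 0`, written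
  -- as `2 - 1`.
  have hterm : ∀ s, star (pbrZeta x s) * pbrState θ x s =
      (1 / (Real.sqrt (2 ^ Fintype.card ι) : ℂ)) *
        ((if s = fun _ => false then 2 * ∏ i, amp (s i) else 0) - ∏ i, amp (s i)) := fun s => by
    rw [hstate]
    by_cases h : s = fun _ => false
    · subst h
      simp [pbrZeta, bitDot]
      ring
    · have h' : ¬ ∀ i, s i = false := fun h' => h (funext h')
      simp only [pbrZeta, if_neg h, if_neg h']
      simp only [star_mul', RCLike.star_def, map_neg, map_pow, map_one, map_div₀,
        Complex.conj_ofReal]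
      linear_combination (-(1 / (Real.sqrt (2 ^ Fintype.card ι) : ℂ)) * ∏ i, amp (s i)) *
        hsq (bitDot x s)
  have hsum : ∑ s : BitString ι, ∏ i, amp (s i) =
      ((Real.cos (θ / 2) + Real.sin (θ / 2) : ℝ) : ℂ) ^ Fintype.card ι := by
    rw [← Fintype.prod_sum (fun (_ : ι) b => amp b)]
    simp [amp, add_comm]
  -- Here `ι` must be nonempty: for no qubits the power would be 1.
  have hpow : ((2 : ℝ) ^ (1 / (Fintype.card ι : ℝ))) ^ Fintype.card ι = 2 := by
    rw [one_div, Real.rpow_inv_natCast_pow zero_le_two Fintype.card_ne_zero]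
  rw [Finset.sum_congr rfl fun s _ => hterm s, ← Finset.mul_sum, Finset.sum_sub_distrib, hsum]
  rw [cos_add_sin_pbrAngle, ← Complex.ofReal_pow, mul_pow, hpow]
  simp [amp, θ]

/-- The amplitudes factor over `y` and its complement, so the contraction is the inner product on
`y` times the amplitude of `c`. -/
theorem conjTranspose_tensorEmbedding_mulVec_pbrState {n : ℕ} (y : Finset (Fin n)) (θ : ℝ)
    (x : BitString (Fin n)) (v : BitString y → ℂ)
    (h : ∑ u, star (v u) * pbrState θ (fun i : y => x i) u = 0) :
    (tensorEmbedding y v)ᴴ *ᵥ pbrState θ x = 0 := by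
  funext c
  simp only [mulVec, dotProduct, conjTranspose_apply, tensorEmbedding, Pi.zero_apply]
  rw [← (Equiv.piEquivPiSubtypeProd (· ∈ y) (fun _ => Bool)).symm.sum_comp,
    Fintype.sum_prod_type]
  refine Eq.trans ?_ ((congrArg (· * ∏ i : {i // i ∉ y}, pbrQubit θ (x i) (c i)) h).trans
    (zero_mul _))
  rw [Finset.sum_mul]
  refine Finset.sum_congr rfl fun u _ => ?_
  rw [Finset.sum_eq_single c]
  · rw [if_pos (by funext i; simp [Equiv.piEquivPiSubtypeProd, i.2]), pbrState, pbrState,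
      ← Fintype.prod_subtype_mul_prod_subtype (· ∈ y), mul_assoc]
    have hin : (fun i : y => (Equiv.piEquivPiSubtypeProd (· ∈ y) (fun _ => Bool)).symm (u, c) i) =
        u := by
      funext i
      simp [Equiv.piEquivPiSubtypeProd]
    rw [hin]
    congr 2
    · refine Finset.prod_congr (Finset.ext fun i => by simp only [Finset.mem_univ]) fun i _ => ?_
      exact congrArg _ (congrFun hin i)
    · refine Finset.prod_congr rfl fun i _ => congrArg _ ?_
      simp [Equiv.piEquivPiSubtypeProd, i.2]
  · intro c' _ hc
    rw [if_neg, star_zero, zero_mul]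
    intro h'
    apply hc
    rw [← h']
    funext i
    simp [Equiv.piEquivPiSubtypeProd, i.2]
  · simp

theorem onSubsystem_pbrZeta_mul_ketBra {n m : ℕ} (hm : 1 ≤ m) (y : Locations n m)
    (x : BitString (Fin n)) :
    onSubsystem y.1 (ketBra (pbrZeta (restrictTo y x))) * ketBra (pbrState (pbrAngle m) x) = 0 := by
  have hcard : Fintype.card y.1 = m := by rw [Fintype.card_coe, y.2]
  have : Nonempty y.1 := Fintype.card_pos_iff.1 (by omega)
  have h := sum_pbrZeta_mul_pbrState (restrictTo y x)
  rw [hcard] at h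
  rw [onSubsystem_ketBra, ketBra, mul_vecMulVec, ← mulVec_mulVec,
    conjTranspose_tensorEmbedding_mulVec_pbrState y.1 _ x _ h]
  simp

/-- The Pusey-Barrett-Rudolph strategy. -/
noncomputable def pbrStrategy (n m : ℕ) : OneWayStrategy n m (BitString (Fin n)) where
  message x := ketBra (pbrState (pbrAngle m) x)
  message_posSemidef _ := posSemidef_ketBra _
  message_trace x := trace_ketBra_pbrState _ x
  measurement y z := onSubsystem y.1 (ketBra (pbrZeta z))
  measurement_posSemidef y _ := posSemidef_onSubsystem_ketBra y.1 _
  measurement_sum y := sum_onSubsystem_pbrZeta y.1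

theorem pbrStrategy_alwaysWins {n m : ℕ} (hm : 1 ≤ m) : (pbrStrategy n m).AlwaysWins := by
  rintro x y z hz rfl
  apply hz
  simp [OneWayStrategy.outputProb, pbrStrategy, onSubsystem_pbrZeta_mul_ketBra hm]

/-! ### The information cost -/

/-- Additivity of entropy: `negMulLog` obeys the Leibniz rule on products, and in each resulting
term the other coordinates sum to 1. -/
theorem sum_negMulLog_prod {ι κ : Type} [Fintype ι] [DecidableEq ι] [Fintype κ] (q : κ → ℝ)
    (hq : ∑ b, q b = 1) :
    ∑ s : ι → κ, Real.negMulLog (∏ i, q (s i)) = Fintype.card ι * ∑ b, Real.negMulLog (q b) := by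
  have hprod : ∀ (t : Finset ι) (s : ι → κ), Real.negMulLog (∏ i ∈ t, q (s i)) =
      ∑ i ∈ t, Real.negMulLog (q (s i)) * ∏ j ∈ t.erase i, q (s j) := fun t s => by
    induction t using Finset.induction_on with
    | empty => simp
    | insert a t ha ih =>
      rw [Finset.prod_insert ha, Real.negMulLog_mul, ih, Finset.sum_insert ha,
        Finset.erase_insert ha, mul_comm, Finset.mul_sum]
      congr 1
      refine Finset.sum_congr rfl fun i hi => ?_
      have hia : i ≠ a := fun h => ha (h ▸ hi)
      rw [Finset.erase_insert_of_ne hia.symm, Finset.prod_insert (by simp [ha])]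
      ring
  simp only [hprod]
  rw [Finset.sum_comm]
  have hterm : ∀ i : ι, ∑ s : ι → κ, Real.negMulLog (q (s i)) *
      ∏ j ∈ Finset.univ.erase i, q (s j) = ∑ b, Real.negMulLog (q b) := fun i => by
    have h1 : ∀ s : ι → κ, Real.negMulLog (q (s i)) * ∏ j ∈ Finset.univ.erase i, q (s j) =
        ∏ j, if j = i then Real.negMulLog (q (s j)) else q (s j) := fun s => by
      rw [← Finset.mul_prod_erase _ _ (Finset.mem_univ i), if_pos rfl]
      congr 1
      exact Finset.prod_congr rfl fun j hj => (if_neg (Finset.ne_of_mem_erase hj)).symm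
    simp only [h1]
    rw [← Fintype.prod_sum (fun (j : ι) b => if j = i then Real.negMulLog (q b) else q b),
      Finset.prod_eq_single i]
    · simp
    · intro j _ hj
      simp [hj, hq]
    · simp
  simp [hterm]

/-! ### Information cost of strategies with pure messages -/

section

variable {n m : ℕ} {d : Type} [Fintype d] [DecidableEq d] (S : OneWayStrategy n m d)
  (μ : BitString (Fin n) × Locations n m → ℝ)

/-- The unnormalized state of the message conditioned on Bob's input `y`. -/
noncomputable def averageMessage (y : Locations n m) : Matrix d d ℂ :=
  ∑ x, (μ (x, y) : ℂ) • S.message x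

theorem trace_averageMessage (y : Locations n m) :
    (averageMessage S μ y).trace = ((∑ x, μ (x, y) : ℝ) : ℂ) := by
  simp [averageMessage, trace_sum, S.message_trace]

theorem posSemidef_averageMessage (hμ : ∀ p, 0 ≤ μ p) (y : Locations n m) :
    (averageMessage S μ y).PosSemidef := by
  refine posSemidef_sum _ fun x _ => (S.message_posSemidef x).smul ?_
  exact_mod_cast hμ (x, y)

theorem reduceAC_jointState :
    reduceAC (S.jointState μ) = diagonal fun p => (μ p : ℂ) := by
  ext ⟨x, y⟩ ⟨x', y'⟩
  have h : ∑ k, S.message x k k = 1 := S.message_trace x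
  simp only [reduceAC, OneWayStrategy.jointState, diagonal_apply, Prod.mk.injEq]
  split_ifs
  · rw [← Finset.mul_sum, h, mul_one]
  · simp

theorem reduceBC_jointState :
    reduceBC (S.jointState μ) = blockDiagonal (averageMessage S μ) := by
  ext ⟨s, y⟩ ⟨s', y'⟩
  simp only [reduceBC, OneWayStrategy.jointState, blockDiagonal_apply, averageMessage, true_and]
  split_ifs <;> simp [Matrix.sum_apply]

theorem reduceC_jointState :
    reduceC (S.jointState μ) = diagonal fun y => ((∑ x, μ (x, y) : ℝ) : ℂ) := by
  ext y y'
  have h : ∀ x, ∑ k, S.message x k k = 1 := S.message_trace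
  simp only [reduceC, OneWayStrategy.jointState, diagonal_apply, true_and]
  split_ifs
  · simp [← Finset.mul_sum, h]
  · simp

/-- Pure messages leave the entropy of the inputs unchanged. -/
theorem vonNeumannEntropy_jointState_of_pure (ψ : BitString (Fin n) → d → ℂ)
    (hψ : ∀ x, S.message x = ketBra (ψ x)) :
    vonNeumannEntropy (S.jointState μ) = (∑ p, Real.negMulLog (μ p)) / Real.log 2 := by
  -- `V` sends `|x, y⟩` to `|x⟩ ⊗ |ψ_x⟩ ⊗ |y⟩`, an isometry since each `ψ_x` is a unit vector; the
  -- joint state is `μ` transported by it.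
  obtain ⟨V, hVa⟩ : ∃ V : Matrix (BitString (Fin n) × d × Locations n m)
      (BitString (Fin n) × Locations n m) ℂ,
      ∀ x s y q, V (x, s, y) q = if (x, y) = q then ψ x s else 0 :=
    ⟨fun p q => if (p.1, p.2.2) = q then ψ p.1 p.2.1 else 0, fun _ _ _ _ => rfl⟩
  have hnorm : ∀ x, ∑ s, star (ψ x s) * ψ x s = 1 := fun x => by
    have := S.message_trace x
    rw [hψ, trace] at this
    simpa [ketBra_apply, mul_comm] using this
  have hV : Vᴴ * V = 1 := by
    ext ⟨x, y⟩ ⟨x', y'⟩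
    rw [mul_apply, Fintype.sum_prod_type, Finset.sum_eq_single x]
    · rw [Fintype.sum_prod_type_right, Finset.sum_eq_single y]
      · by_cases h : x = x' ∧ y = y'
        · obtain ⟨rfl, rfl⟩ := h
          simpa [hVa, conjTranspose_apply] using hnorm x
        · simp [hVa, conjTranspose_apply, one_apply, h]
      · intro b _ hb
        simp [hVa, conjTranspose_apply, hb]
      · simp
    · intro b _ hb
      simp [hVa, conjTranspose_apply, hb]
    · simp
  have hρ : S.jointState μ = V * diagonal (fun p => (μ p : ℂ)) * Vᴴ := by
    ext ⟨x, s, y⟩ ⟨x', s', y'⟩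
    rw [mul_apply, Finset.sum_eq_single (x, y)]
    · by_cases h : x = x' ∧ y = y'
      · obtain ⟨rfl, rfl⟩ := h
        simp [OneWayStrategy.jointState, hVa, conjTranspose_apply, hψ, ketBra_apply, mul_diagonal]
        ring
      · have h' : ¬ (x' = x ∧ y' = y) := fun h' => h ⟨h'.1.symm, h'.2.symm⟩
        simp [OneWayStrategy.jointState, hVa, conjTranspose_apply, h, h']
    · intro b _ hb
      simp [hVa, conjTranspose_apply, mul_diagonal, hb.symm]
    · simp
  rw [hρ, vonNeumannEntropy_isometry_conj_diagonal V hV]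

/-- For pure messages, the information cost is the average entropy of the message given Bob's
input. -/
theorem infoCost_of_pure (hμ : ∀ p, 0 ≤ μ p) (ψ : BitString (Fin n) → d → ℂ)
    (hψ : ∀ x, S.message x = ketBra (ψ x)) :
    S.infoCost μ =
      (∑ y, ((∑ i, Real.negMulLog ((posSemidef_averageMessage S μ hμ y).1.eigenvalues i)) -
        Real.negMulLog (∑ x, μ (x, y)))) / Real.log 2 := by
  rw [OneWayStrategy.infoCost, condMutualInfo, vonNeumannEntropy_jointState_of_pure S μ ψ hψ,
    reduceAC_jointState, reduceBC_jointState, reduceC_jointState, vonNeumannEntropy_diagonal,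
    vonNeumannEntropy_diagonal, vonNeumannEntropy_blockDiagonal _
      fun y => (posSemidef_averageMessage S μ hμ y).1, Finset.sum_sub_distrib]
  ring

theorem infoCost_nonneg_of_pure (hμ : ∀ p, 0 ≤ μ p) (ψ : BitString (Fin n) → d → ℂ)
    (hψ : ∀ x, S.message x = ketBra (ψ x)) : 0 ≤ S.infoCost μ := by
  rw [infoCost_of_pure S μ hμ ψ hψ]
  refine div_nonneg (Finset.sum_nonneg fun y _ => ?_) (Real.log_nonneg one_le_two)
  have := negMulLog_trace_le (posSemidef_averageMessage S μ hμ y)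
  rw [trace_averageMessage, Complex.ofReal_re] at this
  exact sub_nonneg.2 this

/-- If all messages are pure and have the same distribution `Q` in the computational basis, then
the information cost is at most the Shannon entropy of `Q`. -/
theorem infoCost_le_of_pure (hμ : μ ∈ stdSimplex ℝ (BitString (Fin n) × Locations n m))
    (ψ : BitString (Fin n) → d → ℂ) (hψ : ∀ x, S.message x = ketBra (ψ x)) (Q : d → ℝ)
    (hQ : ∀ x s, Complex.normSq (ψ x s) = Q s) (hQ1 : ∑ s, Q s = 1) :
    S.infoCost μ ≤ (∑ s, Real.negMulLog (Q s)) / Real.log 2 := by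
  rw [infoCost_of_pure S μ hμ.1 ψ hψ]
  refine div_le_div_of_nonneg_right ?_ (Real.log_nonneg one_le_two)
  have hdiag : ∀ y s, (averageMessage S μ y s s).re = (∑ x, μ (x, y)) * Q s := fun y s => by
    rw [averageMessage, Matrix.sum_apply, Complex.re_sum, Finset.sum_mul]
    refine Finset.sum_congr rfl fun x _ => ?_
    rw [Matrix.smul_apply, hψ, ketBra_apply, RCLike.star_def, Complex.mul_conj, hQ, smul_eq_mul,
      ← Complex.ofReal_mul, Complex.ofReal_re]
  -- The blocks are unnormalized. With `w` the weight of `y`, the entropy of `w Q` is `negMulLog w +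
  -- w H(Q)`, and the first summand cancels the subtracted term.
  have hterm : ∀ y,
      (∑ i, Real.negMulLog ((posSemidef_averageMessage S μ hμ.1 y).1.eigenvalues i)) -
        Real.negMulLog (∑ x, μ (x, y)) ≤ (∑ x, μ (x, y)) * ∑ s, Real.negMulLog (Q s) := fun y => by
    have := sum_negMulLog_eigenvalues_le (posSemidef_averageMessage S μ hμ.1 y)
    simp only [hdiag, Real.negMulLog_mul, Finset.sum_add_distrib, ← Finset.sum_mul,
      ← Finset.mul_sum, hQ1, one_mul] at this
    linarith
  refine (Finset.sum_le_sum fun y _ => hterm y).trans_eq ?_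
  have hsum : ∑ y, ∑ x, μ (x, y) = 1 := by
    rw [← Fintype.sum_prod_type_right]
    exact hμ.2
  rw [← Finset.sum_mul, hsum, one_mul]

end

theorem infoCost_pbrStrategy_le {n m : ℕ} {μ : BitString (Fin n) × Locations n m → ℝ}
    (hμ : μ ∈ stdSimplex ℝ (BitString (Fin n) × Locations n m)) :
    (pbrStrategy n m).infoCost μ ≤
      n * (Real.negMulLog (Real.sin (pbrAngle m / 2) ^ 2) +
        Real.negMulLog (Real.cos (pbrAngle m / 2) ^ 2)) / Real.log 2 := by
  refine (infoCost_le_of_pure (pbrStrategy n m) μ hμ (pbrState (pbrAngle m)) (fun _ => rfl)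
    (fun s => ∏ i, pbrBitProb (pbrAngle m) (s i)) (normSq_pbrState _)
    (sum_prod_pbrBitProb _)).trans_eq ?_
  rw [sum_negMulLog_prod _ (sum_pbrBitProb _)]
  simp [pbrBitProb]

/-! ### Asymptotics -/

/-- This is `log t ≤ t^ε / ε` at `t = 1/p`, multiplied by `p`. -/
theorem negMulLog_le_rpow {p ε : ℝ} (hp : 0 < p) (hε : 0 < ε) :
    Real.negMulLog p ≤ p ^ (1 - ε) / ε := by
  have h := Real.log_le_rpow_div (inv_pos.2 hp).le hε
  rw [Real.log_inv, Real.inv_rpow hp.le] at h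
  rw [Real.rpow_sub hp, Real.rpow_one, Real.negMulLog]
  calc -p * Real.log p = p * -Real.log p := by ring
    _ ≤ p * ((p ^ ε)⁻¹ / ε) := mul_le_mul_of_nonneg_left h hp.le
    _ = p / p ^ ε / ε := by ring

theorem negMulLog_one_sub_le {p : ℝ} (hp : p ≤ 1) : Real.negMulLog (1 - p) ≤ p := by
  rcases hp.eq_or_lt with rfl | h
  · simp
  · have hpos : 0 < 1 - p := sub_pos.2 h
    have := Real.one_sub_inv_le_log_of_pos hpos
    have h2 := mul_le_mul_of_nonneg_left this hpos.le
    rw [mul_sub, mul_inv_cancel₀ hpos.ne'] at h2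
    rw [Real.negMulLog]
    linarith

/-- Bernoulli's inequality for `(1 + 1)^(1/r)`, whose exponent is at most 1. -/
theorem two_rpow_one_div_sub_one_le {r : ℕ} (hr : 1 ≤ r) :
    (2 : ℝ) ^ (1 / (r : ℝ)) - 1 ≤ 1 / r := by
  have hr' : (1 : ℝ) ≤ r := by exact_mod_cast hr
  have := rpow_one_add_le_one_add_mul_self (s := (1 : ℝ)) (by norm_num)
    (p := 1 / (r : ℝ)) (by positivity) (by rw [div_le_one (by positivity)]; exact hr')
  norm_num at this ⊢
  linarith

theorem sin_sq_pbrAngle_pos {r : ℕ} (hr : 1 ≤ r) : 0 < Real.sin (pbrAngle r / 2) ^ 2 := by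
  have h1 : (1 : ℝ) < 2 ^ (1 / (r : ℝ)) := Real.one_lt_rpow (by norm_num) (by positivity)
  rw [pbrAngle, mul_div_cancel_left₀ _ two_ne_zero, Real.sin_arctan]
  have : (2 : ℝ) ^ (1 / (r : ℝ)) - 1 > 0 := by linarith
  positivity

/-- With `t = 2^(1/r) - 1`, `sin² (arctan t) = t² / (1 + t²) ≤ t²`. -/
theorem sin_sq_pbrAngle_le {r : ℕ} (hr : 1 ≤ r) :
    Real.sin (pbrAngle r / 2) ^ 2 ≤ 1 / (r : ℝ) ^ 2 := by
  have h1 : (1 : ℝ) ≤ 2 ^ (1 / (r : ℝ)) := Real.one_le_rpow (by norm_num) (by positivity)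
  rw [pbrAngle, mul_div_cancel_left₀ _ two_ne_zero, Real.sin_sq_arctan, ← _root_.one_div_pow]
  refine (div_le_self (sq_nonneg _) (le_add_of_nonneg_right (sq_nonneg _))).trans ?_
  exact pow_le_pow_left₀ (by linarith) (two_rpow_one_div_sub_one_le hr) 2

theorem mul_binEntropy_pbrAngle_le {n r : ℕ} {β : ℝ} (hβ : 0 < β) (hn : 1 ≤ n)
    (hr : (n : ℝ) ^ (1 / 2 + β) ≤ r) :
    n * (Real.negMulLog (Real.sin (pbrAngle r / 2) ^ 2) +
      Real.negMulLog (Real.cos (pbrAngle r / 2) ^ 2)) ≤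
      (1 + (1 + 2 * β) / β) * (n : ℝ) ^ (-β) := by
  have hn' : (1 : ℝ) ≤ n := by exact_mod_cast hn
  have hr1 : 1 ≤ r := by
    have := (Real.one_le_rpow hn' (by positivity : 0 ≤ 1 / 2 + β)).trans hr
    exact_mod_cast this
  set p := Real.sin (pbrAngle r / 2) ^ 2 with hp
  have hp0 : 0 < p := sin_sq_pbrAngle_pos hr1
  have hp1 : p ≤ 1 := Real.sin_sq_le_one _
  have hcos : Real.cos (pbrAngle r / 2) ^ 2 = 1 - p := Real.cos_sq' _
  -- This `ε` satisfies `(1 - ε)(1 + 2β) = 1 + β`: from `p ≤ n^(-(1 + 2β))` it gives `p^(1 - ε) ≤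
  -- n^(-(1 + β))`, so the prefactor `n` still leaves `n^(-β)`.
  have hε : 0 < β / (1 + 2 * β) := by positivity
  have hexp : 1 - β / (1 + 2 * β) = (1 + β) / (1 + 2 * β) := by field_simp; ring
  have hple : p ≤ (n : ℝ) ^ (-(1 + 2 * β)) := by
    refine (sin_sq_pbrAngle_le hr1).trans ?_
    rw [Real.rpow_neg (by positivity), ← one_div]
    refine one_div_le_one_div_of_le (by positivity) ?_
    calc (n : ℝ) ^ (1 + 2 * β) = ((n : ℝ) ^ (1 / 2 + β)) ^ 2 := by
          rw [← Real.rpow_mul_natCast (by positivity)]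
          congr 1
          push_cast
          ring
      _ ≤ (r : ℝ) ^ 2 := pow_le_pow_left₀ (by positivity) hr 2
  have hpow : p ^ (1 - β / (1 + 2 * β)) ≤ (n : ℝ) ^ (-(1 + β)) := by
    rw [hexp]
    refine (Real.rpow_le_rpow hp0.le hple (by positivity)).trans_eq ?_
    rw [← Real.rpow_mul (by positivity)]
    congr 1
    field_simp
  -- Absorbs the linear bound on `negMulLog (1 - p)` into the same power.
  have hself : p ≤ p ^ (1 - β / (1 + 2 * β)) := by
    conv_lhs => rw [← Real.rpow_one p]
    exact Real.rpow_le_rpow_of_exponent_ge hp0 hp1 (by linarith)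
  have h1 := negMulLog_le_rpow hp0 hε
  have h2 := negMulLog_one_sub_le hp1
  rw [hcos]
  calc n * (Real.negMulLog p + Real.negMulLog (1 - p))
      ≤ n * ((1 + (1 + 2 * β) / β) * p ^ (1 - β / (1 + 2 * β))) := by
        refine mul_le_mul_of_nonneg_left ?_ (by positivity)
        have : p ^ (1 - β / (1 + 2 * β)) / (β / (1 + 2 * β)) =
          (1 + 2 * β) / β * p ^ (1 - β / (1 + 2 * β)) := by field_simp
        linarith
    _ ≤ n * ((1 + (1 + 2 * β) / β) * (n : ℝ) ^ (-(1 + β))) := by gcongr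
    _ = (1 + (1 + 2 * β) / β) * (n : ℝ) ^ (-β) := by
        have : (n : ℝ) ^ (-β) = n * (n : ℝ) ^ (-(1 + β)) := by
          rw [← Real.rpow_one_add' (by positivity) (by linarith)]
          congr 1
          ring
        rw [this]
        ring

theorem tendsto_mul_binEntropy_pbrAngle {m : ℕ → ℕ} {β : ℝ} (hβ : 0 < β)
    (hω : (fun n : ℕ => (n : ℝ) ^ (1 / 2 + β)) =o[atTop] (fun n : ℕ => (m n : ℝ))) :
    Tendsto (fun n : ℕ => n * (Real.negMulLog (Real.sin (pbrAngle (m n) / 2) ^ 2) +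
      Real.negMulLog (Real.cos (pbrAngle (m n) / 2) ^ 2))) atTop (𝓝 0) := by
  have hlim : Tendsto (fun n : ℕ => (1 + (1 + 2 * β) / β) * (n : ℝ) ^ (-β)) atTop (𝓝 0) := by
    simpa using ((tendsto_rpow_neg_atTop hβ).comp tendsto_natCast_atTop_atTop).const_mul
      (1 + (1 + 2 * β) / β)
  refine squeeze_zero' (Eventually.of_forall fun n => ?_) ?_ hlim
  · exact mul_nonneg n.cast_nonneg (add_nonneg
      (Real.negMulLog_nonneg (sq_nonneg _) (Real.sin_sq_le_one _))
      (Real.negMulLog_nonneg (sq_nonneg _) (Real.cos_sq_le_one _)))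
  · filter_upwards [hω.bound one_pos, eventually_ge_atTop 1] with n hn hn1
    refine mul_binEntropy_pbrAngle_le hβ hn1 ?_
    rwa [Real.norm_of_nonneg (by positivity), Real.norm_of_nonneg (by positivity), one_mul] at hn

end ExclusionGame

theorem theorem1 (m : ℕ → ℕ) (hm : ∀ n, m n ≤ n) (β : ℝ) (hβ : 0 < β)
    (hω : (fun n : ℕ => (n : ℝ) ^ (1 / 2 + β)) =o[atTop] (fun n : ℕ => (m n : ℝ))) :
    ∃ S : (n : ℕ) → OneWayStrategy n (m n) (BitString (Fin n)),
      (∀ n x, (S n).message x = ketBra (pbrState (pbrAngle (m n)) x)) ∧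
      (∀ n (y : Locations n (m n)) (z : BitString y.1),
        (S n).measurement y z = onSubsystem y.1 (ketBra (pbrZeta z))) ∧
      (∀ n, 1 ≤ m n → (S n).AlwaysWins) ∧
      (∀ μ : (n : ℕ) → BitString (Fin n) × Locations n (m n) → ℝ,
        (∀ n, μ n ∈ stdSimplex ℝ (BitString (Fin n) × Locations n (m n))) →
        Tendsto (fun n => (S n).infoCost (μ n)) atTop (𝓝 0)) := by
  refine ⟨fun n => pbrStrategy n (m n), fun _ _ => rfl, fun _ _ _ => rfl,
    fun _ h => pbrStrategy_alwaysWins h, fun μ hμ => ?_⟩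
  refine squeeze_zero (fun n => ?_) (fun n => infoCost_pbrStrategy_le (hμ n)) ?_
  · exact infoCost_nonneg_of_pure _ _ (hμ n).1 (pbrState (pbrAngle (m n))) fun _ => rfl
  · simpa using (tendsto_mul_binEntropy_pbrAngle hβ hω).div_const (Real.log 2)
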